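/- Let $\{\phi_t\}_{t\in\mathbb Z^d}$ be a nonsingular action of $\mathbb Z^d$ on a standard Borel space $(S,\mathcal S)$ with a $\sigma$-finite measure $\mu$: $\phi_0=\mathrm{id}$, $\phi_{t+u}=\phi_t\circ\phi_u$, and each $\phi_t$ is measurable and preserves the class of $\mu$-null sets. Write $\mu\circ\phi_t$ for the measure $A\mapsto\mu(\phi_t(A))$ and, for $g\in L^1(\mu)$, $$\hat\phi_t g(s)=g(\phi_t(s))\,\frac{d(\mu\circ\phi_t)}{d\mu}(s),\qquad M_n(g)=\frac1{n^d}\int_S\max_{0\le t\le(n-1)\mathbf 1}\hat\phi_t g(s)\,\mu(ds),$$ where the maximum is over all $t\in\mathbb Z^d$ with $0\le t_i\le n-1$ for every $i$. A measurable set $W\subseteq S$ is wandering if the sets $\phi_t(W)$, $t\in\mathbb Z^d$, are pairwise disjoint. The action is conservative if every wandering set is $\mu$-null. The dissipative part $\mathcal D$ is the measurable set, unique up to $\mu$-null sets, that contains every wandering set modulo $\mu$ and is modulo $\mu$ a countable union of wandering sets; the conservative part is $\mathcal C=S\setminus\mathcal D$. Let $\mathrm{Support}(g)=\{g\ne0\}$.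 For every $g\in L^1(\mu)$ with $g\ge0$, the function $\max_{0\le t\le(n-1)\mathbf 1}\hat\phi_t g$ is $\mu$-integrable for every $n \geq 1$, and the following hold. 1. If $g\in L^1(\mu)$, $g\ge0$ and $\mu(\mathrm{Support}(g)\cap\mathcal D)>0$, then $M_n(g)\to a$ as $n\to\infty$ for some $0<a<\infty$. 2. Consequently, if $g\in L^1(\mu)$, $g\ge0$ and $M_n(g)\to0$, then $\mathrm{Support}(g)\subseteq\mathcal C$ modulo $\mu$. In particular, if there are $g_m\in L^1(\mu)$, $g_m\ge0$ $(m\ge1)$, whose supports increase to $S$ modulo $\mu$ and such that $M_n(g_m)\to0$ as $n\to\infty$ for every $m$, then $\{\phi_t\}$ is conservative. -/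

import Mathlib

open MeasureTheory Filter Topology

namespace ZdAction

/-- An action of `ℤ^d` on a measure space, written `φ_t(s) = t +ᵥ s`, is nonsingular if every `φ_t`
is measurable and pulls `μ`-null sets back to `μ`-null sets. As `φ_{-t}` is the inverse of `φ_t`,
each `φ_t` is then bimeasurable and preserves the class of `μ`-null sets. -/
def IsNonsingular (d : ℕ) {S : Type*} [MeasurableSpace S] [AddAction (Fin d → ℤ) S]
    (μ : Measure S) : Prop :=
  ∀ t : Fin d → ℤ, Measure.QuasiMeasurePreserving (fun s : S => t +ᵥ s) μ μ

/-- A wandering set: a measurable set whose translates `φ_t(W)`, `t ∈ ℤ^d`, are pairwise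
disjoint. -/
def IsWandering (d : ℕ) {S : Type*} [MeasurableSpace S] [AddAction (Fin d → ℤ) S]
    (W : Set S) : Prop :=
  MeasurableSet W ∧ Pairwise fun t u : Fin d → ℤ =>
    Disjoint ((fun s : S => t +ᵥ s) '' W) ((fun s : S => u +ᵥ s) '' W)

/-- The action is conservative if every wandering set is `μ`-null. -/
def IsConservative (d : ℕ) {S : Type*} [MeasurableSpace S] [AddAction (Fin d → ℤ) S]
    (μ : Measure S) : Prop :=
  ∀ W : Set S, IsWandering d W → μ W = 0

/-- `D` is (a version of) the dissipative part of the action: the measurable union of the wandering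
sets, that is, up to a `μ`-null set, `D` is a countable union of wandering sets, and it contains
every wandering set. Its complement is the conservative part. -/
structure IsDissipativePart (d : ℕ) {S : Type*} [MeasurableSpace S] [AddAction (Fin d → ℤ) S]
    (μ : Measure S) (D : Set S) : Prop where
  measurableSet : MeasurableSet D
  exists_iUnion : ∃ W : ℕ → Set S, (∀ k, IsWandering d (W k)) ∧ D =ᵐ[μ] ⋃ k, W k
  ae_le : ∀ W : Set S, IsWandering d W → W ≤ᵐ[μ] D

/-- The dissipative part is unique up to `μ`-null sets. -/
theorem IsDissipativePart.ae_eq {d : ℕ} {S : Type*} [MeasurableSpace S]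
    [AddAction (Fin d → ℤ) S] {μ : Measure S} {D E : Set S}
    (hD : IsDissipativePart d μ D) (hE : IsDissipativePart d μ E) : D =ᵐ[μ] E := by
  have key : ∀ A B : Set S, IsDissipativePart d μ A → IsDissipativePart d μ B → A ≤ᵐ[μ] B := by
    intro A B hA hB
    obtain ⟨W, hW, hAW⟩ := hA.exists_iUnion
    refine hAW.le.trans ?_
    have h : ∀ᵐ s ∂μ, ∀ k, s ∈ W k → s ∈ B := ae_all_iff.2 fun k => hB.ae_le _ (hW k)
    filter_upwards [h] with s hs hsW
    obtain ⟨k, hk⟩ := Set.mem_iUnion.1 hsW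
    exact hs k hk
  exact (key D E hD hE).antisymm (key E D hE hD)

/-- The dissipative part exists. -/
theorem exists_isDissipativePart (d : ℕ) {S : Type*} [MeasurableSpace S]
    [AddAction (Fin d → ℤ) S] (μ : Measure S) [SigmaFinite μ] :
    ∃ D : Set S, IsDissipativePart d μ D := by
  let ν : Measure S := μ.toFinite
  have hemp : IsWandering d (∅ : Set S) := ⟨MeasurableSet.empty, fun t u _ => by simp⟩
  let c : ENNReal := ⨆ V : {V : ℕ → Set S // ∀ k, IsWandering d (V k)}, ν (⋃ k, V.1 k)
  have : Nonempty {V : ℕ → Set S // ∀ k, IsWandering d (V k)} := ⟨⟨fun _ => ∅, fun _ => hemp⟩⟩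
  obtain ⟨u, -, hu⟩ := exists_seq_tendsto_sSup
    (Set.range_nonempty fun V : {V : ℕ → Set S // ∀ k, IsWandering d (V k)} => ν (⋃ k, V.1 k))
    (OrderTop.bddAbove _)
  choose V hV using hu.2
  let W : ℕ → Set S := fun k => (V k.unpair.1).1 k.unpair.2
  have hW : ∀ k, IsWandering d (W k) := fun k => (V k.unpair.1).2 _
  have hsub : ∀ m, (⋃ k, (V m).1 k) ⊆ ⋃ k, W k := by
    intro m
    refine Set.iUnion_subset fun k => ?_
    have : (V m).1 k = W (Nat.pair m k) := by simp [W]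
    rw [this]
    exact Set.subset_iUnion W _
  have hge : c ≤ ν (⋃ k, W k) :=
    le_of_tendsto' hu.1 fun m => by
      rw [← hV m]
      exact measure_mono (hsub m)
  have hmeas : MeasurableSet (⋃ k, W k) := MeasurableSet.iUnion fun k => (hW k).1
  refine ⟨⋃ k, W k, hmeas, ⟨W, hW, EventuallyEq.rfl⟩, fun A hA => ?_⟩
  let W' : ℕ → Set S := fun k => Nat.casesOn k A W
  have hW' : ∀ k, IsWandering d (W' k) := by
    intro k
    cases k with
    | zero => exact hA
    | succ k => exact hW k
  have hle : ν (⋃ k, W' k) ≤ c :=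
    le_iSup (fun V : {V : ℕ → Set S // ∀ k, IsWandering d (V k)} => ν (⋃ k, V.1 k)) ⟨W', hW'⟩
  have hsup : (⋃ k, W k) ∪ (A \ ⋃ k, W k) ⊆ ⋃ k, W' k := by
    rintro s (hs | hs)
    · obtain ⟨k, hk⟩ := Set.mem_iUnion.1 hs
      exact Set.mem_iUnion.2 ⟨k + 1, hk⟩
    · exact Set.mem_iUnion.2 ⟨0, hs.1⟩
  have h1 : ν (⋃ k, W k) + ν (A \ ⋃ k, W k) ≤ ν (⋃ k, W k) + 0 := by
    rw [← measure_union Set.disjoint_sdiff_right (hA.1.diff hmeas), add_zero]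
    exact (measure_mono hsup).trans (hle.trans hge)
  have h2 : ν (A \ ⋃ k, W k) = 0 :=
    le_antisymm ((ENNReal.add_le_add_iff_left (measure_ne_top ν _)).1 h1) zero_le
  have h3 : μ (A \ ⋃ k, W k) = 0 := absolutelyContinuous_toFinite μ h2
  exact ae_le_set.2 h3

/-- The dual operator `φ̂_t g(s) = g(φ_t(s)) · (d(μ ∘ φ_t)/dμ)(s)`. Here `μ ∘ φ_t` is the measure
`A ↦ μ(φ_t(A))`, which is the image of `μ` under `φ_{-t}`. -/
noncomputable def dual (d : ℕ) {S : Type*} [MeasurableSpace S] [AddAction (Fin d → ℤ) S]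
    (μ : Measure S) (t : Fin d → ℤ) (g : S → ℝ) (s : S) : ℝ :=
  g (t +ᵥ s) * ((μ.map fun x : S => (-t) +ᵥ x).rnDeriv μ s).toReal

/-- `max_{0 ≤ t ≤ (n-1)𝟏} φ̂_t g(s)`, over the finite box of all `t ∈ ℤ^d` with
`0 ≤ t_i ≤ n - 1` for every `i` (which is nonempty for `n ≥ 1`). -/
noncomputable def maxDual (d : ℕ) {S : Type*} [MeasurableSpace S] [AddAction (Fin d → ℤ) S]
    (μ : Measure S) (g : S → ℝ) (n : ℕ) (s : S) : ℝ :=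
  ⨆ t : Set.Icc (0 : Fin d → ℤ) (fun _ => (n : ℤ) - 1), dual d μ t g s

/-- `n^{-d} ∫_S max_{0 ≤ t ≤ (n-1)𝟏} φ̂_t g(s) μ(ds)`. -/
noncomputable def avgMax (d : ℕ) {S : Type*} [MeasurableSpace S] [AddAction (Fin d → ℤ) S]
    (μ : Measure S) (g : S → ℝ) (n : ℕ) : ℝ :=
  (1 / (n : ℝ) ^ d) * ∫ s, maxDual d μ g n s ∂μ

end ZdAction

/-!
The dual operators `φ̂_t` are positive, preserve integrals and satisfy
`φ̂_u (φ̂_t g) = φ̂_{t+u} g` almost everywhere; the last fact is the chain rule for the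
Radon–Nikodym derivatives `d(μ ∘ φ_t)/dμ`.

Write `F n` for the integral of the maximum over the cube of side `n`. A cube of side `n` is covered
by `(n / m + 1) ^ d` translates of the cube of side `m`, so `F n ≤ (n / m + 1) ^ d * F m`
(`integral_maxDual_le`). Fekete's argument then shows that `F n / n ^ d` always converges to its
infimum (`tendsto_div_pow_sInf`, `tendsto_avgMax`).

The limit is positive as soon as `g` charges a wandering set `W`: the functions
`φ̂_t (1_W g)` have disjoint supports, so the maximum of the `φ̂_t g` over the cube dominates their
sum, whence `F n ≥ n ^ d * ∫_W g` (`setIntegral_le_avgMax`). If the support of `g` meets the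
dissipative part in positive measure, it meets one of countably many wandering sets in positive
measure. The statements about the conservative part follow by contraposition.
-/

open MeasureTheory Filter Topology

namespace ZdAction

/-! ### Fekete's argument on cubes -/

/-- A nonnegative sequence `F` with `F n ≤ (n / m + 1) ^ d * F m` satisfies
`F n / n ^ d → inf_{m ≥ 1} F m / m ^ d`. -/
theorem tendsto_div_pow_sInf (d : ℕ) (F : ℕ → ℝ) (hF : ∀ n, 0 ≤ F n)
    (h : ∀ m n : ℕ, 1 ≤ m → 1 ≤ n → F n ≤ ((n / m : ℕ) + 1 : ℝ) ^ d * F m) :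
    Tendsto (fun n : ℕ => 1 / (n : ℝ) ^ d * F n) atTop
      (𝓝 (sInf ((fun n : ℕ => 1 / (n : ℝ) ^ d * F n) '' Set.Ici 1))) := by
  set u : ℕ → ℝ := fun n => 1 / (n : ℝ) ^ d * F n with hu
  have hbdd : BddBelow (u '' Set.Ici 1) := by
    refine ⟨0, ?_⟩
    rintro _ ⟨n, -, rfl⟩
    exact mul_nonneg (by positivity) (hF n)
  refine tendsto_order.2 ⟨fun a ha => ?_, fun a ha => ?_⟩
  · filter_upwards [eventually_ge_atTop 1] with n hn
    exact ha.trans_le (csInf_le hbdd ⟨n, hn, rfl⟩)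
  · obtain ⟨_, ⟨m, hm, rfl⟩, hma⟩ :=
      exists_lt_of_csInf_lt (Set.Nonempty.image _ Set.nonempty_Ici) ha
    have hm' : (0 : ℝ) < m := by exact_mod_cast (Set.mem_Ici.1 hm)
    have hlim : Tendsto (fun n : ℕ => (1 / (m : ℝ) + 1 / (n : ℝ)) ^ d * F m) atTop
        (𝓝 (u m)) := by
      have h0 : Tendsto (fun n : ℕ => 1 / (n : ℝ)) atTop (𝓝 0) := tendsto_one_div_atTop_nhds_zero_nat
      have h1 := (((tendsto_const_nhds (x := 1 / (m : ℝ))).add h0).pow d).mul_const (F m)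
      simpa [hu] using h1
    filter_upwards [hlim.eventually_lt_const hma, eventually_ge_atTop 1] with n hn hn1
    refine lt_of_le_of_lt ?_ hn
    have hn' : (0 : ℝ) < n := by exact_mod_cast hn1
    have hq : ((n / m : ℕ) + 1 : ℝ) ≤ n * (1 / (m : ℝ) + 1 / n) := by
      have : ((n / m : ℕ) : ℝ) ≤ n / m := Nat.cast_div_le
      calc ((n / m : ℕ) + 1 : ℝ) ≤ n / m + 1 := by linarith
        _ = n * (1 / (m : ℝ) + 1 / n) := by field_simp
    calc u n ≤ 1 / (n : ℝ) ^ d * ((n * (1 / (m : ℝ) + 1 / n)) ^ d * F m) := by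
          refine mul_le_mul_of_nonneg_left ((h m n hm hn1).trans ?_) (by positivity)
          exact mul_le_mul_of_nonneg_right (pow_le_pow_left₀ (by positivity) hq d) (hF m)
      _ = (1 / (m : ℝ) + 1 / n) ^ d * F m := by
          rw [mul_pow]
          field_simp

/-! ### The dual operators -/

section Dual

variable {d : ℕ} {S : Type*} [MeasurableSpace S] {μ : Measure S} [AddAction (Fin d → ℤ) S]

/-- The measurable automorphism `s ↦ t +ᵥ s` of a nonsingular action. -/
def vaddEquiv (hφ : IsNonsingular d μ) (t : Fin d → ℤ) : S ≃ᵐ S where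
  toEquiv := AddAction.toPerm t
  measurable_toFun := (hφ t).measurable
  measurable_invFun := (hφ (-t)).measurable

theorem sigmaFinite_map_vadd [SigmaFinite μ] (hφ : IsNonsingular d μ) (t : Fin d → ℤ) :
    SigmaFinite (μ.map fun x : S => t +ᵥ x) :=
  (vaddEquiv hφ t).sigmaFinite_map

theorem lintegral_vadd_mul_rnDeriv [SigmaFinite μ] (hφ : IsNonsingular d μ) (t : Fin d → ℤ)
    {f : S → ENNReal} (hf : Measurable f) :
    ∫⁻ s, f (t +ᵥ s) * (μ.map fun x : S => (-t) +ᵥ x).rnDeriv μ s ∂μ = ∫⁻ s, f s ∂μ := by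
  have hm : Measurable fun s : S => f (t +ᵥ s) := hf.comp (hφ t).measurable
  calc ∫⁻ s, f (t +ᵥ s) * (μ.map fun x : S => (-t) +ᵥ x).rnDeriv μ s ∂μ
      = ∫⁻ s, (μ.map fun x : S => (-t) +ᵥ x).rnDeriv μ s * f (t +ᵥ s) ∂μ := by
        simp_rw [mul_comm]
    _ = ∫⁻ s, f (t +ᵥ s) ∂(μ.map fun x : S => (-t) +ᵥ x) :=
        lintegral_rnDeriv_mul (hφ (-t)).absolutelyContinuous hm.aemeasurable
    _ = ∫⁻ s, f s ∂μ := by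
        rw [lintegral_map hm (hφ (-t)).measurable]
        simp

/-- The chain rule `d(μ ∘ φ_{t+u})/dμ = (d(μ ∘ φ_t)/dμ ∘ φ_u) · d(μ ∘ φ_u)/dμ`. -/
theorem rnDeriv_map_vadd_add [SigmaFinite μ] (hφ : IsNonsingular d μ) (t u : Fin d → ℤ) :
    ∀ᵐ s ∂μ, (μ.map fun x : S => (-(t + u)) +ᵥ x).rnDeriv μ s =
      (μ.map fun x : S => (-t) +ᵥ x).rnDeriv μ (u +ᵥ s) *
        (μ.map fun x : S => (-u) +ᵥ x).rnDeriv μ s := by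
  set w : (Fin d → ℤ) → S → ENNReal := fun t => (μ.map fun x : S => (-t) +ᵥ x).rnDeriv μ
  have hwm : ∀ t, Measurable (w t) := fun t => Measure.measurable_rnDeriv _ _
  have hm : Measurable fun s => w t (u +ᵥ s) * w u s :=
    ((hwm t).comp (hφ u).measurable).mul (hwm u)
  have key : μ.withDensity (fun s => w t (u +ᵥ s) * w u s) =
      μ.map fun x : S => (-(t + u)) +ᵥ x := by
    ext A hA
    rw [withDensity_apply _ hA, ← lintegral_indicator hA,
      Measure.map_apply (hφ _).measurable hA,
      ← lintegral_indicator_one ((hφ (-(t + u))).measurable hA)]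
    have h1 : ∀ s, A.indicator (fun s => w t (u +ᵥ s) * w u s) s =
        (fun x => A.indicator 1 ((-u) +ᵥ x) * w t x) (u +ᵥ s) * w u s := by
      intro s
      by_cases hs : s ∈ A <;> simp [hs]
    have hA1 : Measurable (A.indicator (1 : S → ENNReal)) := measurable_one.indicator hA
    rw [lintegral_congr h1]
    refine (lintegral_vadd_mul_rnDeriv hφ u
      ((hA1.comp (hφ (-u)).measurable).mul (hwm t))).trans ?_
    have h2 : ∀ x : S, A.indicator (1 : S → ENNReal) ((-u) +ᵥ x) * w t x =
        (fun y => A.indicator (1 : S → ENNReal) ((-(t + u)) +ᵥ y)) (t +ᵥ x) * w t x := by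
      intro x
      simp only [vadd_vadd]
      congr 3
      abel
    refine (lintegral_congr h2).trans ?_
    exact lintegral_vadd_mul_rnDeriv hφ t (hA1.comp (hφ (-(t + u))).measurable)
  have := Measure.rnDeriv_withDensity μ hm
  rw [key] at this
  exact this

theorem dual_dual [SigmaFinite μ] (hφ : IsNonsingular d μ) (t u : Fin d → ℤ) (g : S → ℝ) :
    dual d μ u (dual d μ t g) =ᵐ[μ] dual d μ (t + u) g := by
  filter_upwards [rnDeriv_map_vadd_add hφ t u] with s hs
  simp only [dual, hs, ENNReal.toReal_mul, vadd_vadd]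
  ring

theorem integrable_dual [SigmaFinite μ] (hφ : IsNonsingular d μ) (t : Fin d → ℤ) {g : S → ℝ}
    (hg : Integrable g μ) : Integrable (dual d μ t g) μ := by
  have := sigmaFinite_map_vadd hφ (-t)
  have h : Integrable (fun s : S => g (t +ᵥ s)) (μ.map fun x : S => (-t) +ᵥ x) := by
    refine ((vaddEquiv hφ (-t)).measurableEmbedding.integrable_map_iff).2 ?_
    refine hg.congr (Eventually.of_forall fun s => ?_)
    exact congrArg g (vadd_neg_vadd t s).symm
  have h2 := (integrable_rnDeriv_smul_iff (hφ (-t)).absolutelyContinuous).2 h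
  exact h2.congr (Eventually.of_forall fun s => mul_comm _ _)

theorem integral_dual [SigmaFinite μ] (hφ : IsNonsingular d μ) (t : Fin d → ℤ) (g : S → ℝ) :
    ∫ s, dual d μ t g s ∂μ = ∫ s, g s ∂μ := by
  have := sigmaFinite_map_vadd hφ (-t)
  calc ∫ s, dual d μ t g s ∂μ
      = ∫ s, ((μ.map fun x : S => (-t) +ᵥ x).rnDeriv μ s).toReal • g (t +ᵥ s) ∂μ := by
        simp only [dual, smul_eq_mul, mul_comm]
    _ = ∫ s, g (t +ᵥ s) ∂(μ.map fun x : S => (-t) +ᵥ x) :=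
        integral_rnDeriv_smul (hφ (-t)).absolutelyContinuous
    _ = ∫ s, g (t +ᵥ ((-t) +ᵥ s)) ∂μ :=
        (vaddEquiv hφ (-t)).measurableEmbedding.integral_map _
    _ = ∫ s, g s ∂μ := by simp

theorem dual_mono {g h : S → ℝ} (hgh : ∀ s, g s ≤ h s) (t : Fin d → ℤ) (s : S) :
    dual d μ t g s ≤ dual d μ t h s :=
  mul_le_mul_of_nonneg_right (hgh _) ENNReal.toReal_nonneg

theorem dual_nonneg (hφ : IsNonsingular d μ) {g : S → ℝ} (hg : 0 ≤ᵐ[μ] g) :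
    ∀ᵐ s ∂μ, ∀ t, 0 ≤ dual d μ t g s := by
  refine ae_all_iff.2 fun t => ?_
  filter_upwards [(hφ t).ae hg] with s hs
  exact mul_nonneg hs ENNReal.toReal_nonneg

/-! ### Maxima over cubes -/

theorem dual_le_maxDual (g : S → ℝ) (n : ℕ) {t : Fin d → ℤ}
    (ht : t ∈ Set.Icc (0 : Fin d → ℤ) (fun _ => (n : ℤ) - 1)) (s : S) :
    dual d μ t g s ≤ maxDual d μ g n s :=
  le_ciSup (f := fun t : Set.Icc (0 : Fin d → ℤ) (fun _ => (n : ℤ) - 1) => dual d μ t g s)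
    (Set.finite_range _).bddAbove ⟨t, ht⟩

theorem maxDual_le {g : S → ℝ} {n : ℕ} {s : S} {c : ℝ} (hc : 0 ≤ c)
    (h : ∀ t ∈ Set.Icc (0 : Fin d → ℤ) (fun _ => (n : ℤ) - 1), dual d μ t g s ≤ c) :
    maxDual d μ g n s ≤ c :=
  Real.iSup_le (fun t => h t t.2) hc

theorem maxDual_nonneg (hφ : IsNonsingular d μ) {g : S → ℝ} (hg : 0 ≤ᵐ[μ] g) (n : ℕ) :
    0 ≤ᵐ[μ] maxDual d μ g n := by
  filter_upwards [dual_nonneg hφ hg] with s hs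
  exact Real.iSup_nonneg fun t => hs t

theorem integrable_maxDual [SigmaFinite μ] (hφ : IsNonsingular d μ) {g : S → ℝ}
    (hg : Integrable g μ) (hg0 : 0 ≤ᵐ[μ] g) (n : ℕ) : Integrable (maxDual d μ g n) μ := by
  have hsum : Integrable (fun s => ∑ t ∈ Finset.Icc (0 : Fin d → ℤ) (fun _ => (n : ℤ) - 1),
      dual d μ t g s) μ := integrable_finsetSum _ fun t _ => integrable_dual hφ t hg
  have hmeas : AEMeasurable (maxDual d μ g n) μ :=
    AEMeasurable.iSup fun t => (integrable_dual hφ t hg).aemeasurable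
  refine hsum.mono' hmeas.aestronglyMeasurable ?_
  filter_upwards [dual_nonneg hφ hg0, maxDual_nonneg hφ hg0 n] with s hs hs'
  rw [Real.norm_of_nonneg hs']
  refine maxDual_le (Finset.sum_nonneg fun t _ => hs t) fun t ht => ?_
  exact Finset.single_le_sum (f := fun t => dual d μ t g s) (fun t _ => hs t) (Finset.mem_Icc.2 ht)

/-- The cube of side `n` is covered by `(n / m + 1) ^ d` translates of the cube of side `m`, each of
which contributes at most the integral for side `m`. -/
theorem integral_maxDual_le [SigmaFinite μ] (hφ : IsNonsingular d μ) {g : S → ℝ}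
    (hg : Integrable g μ) (hg0 : 0 ≤ᵐ[μ] g) (m n : ℕ) (hm : 1 ≤ m) :
    ∫ s, maxDual d μ g n s ∂μ ≤ ((n / m : ℕ) + 1 : ℝ) ^ d * ∫ s, maxDual d μ g m s ∂μ := by
  set K : Finset (Fin d → ℤ) := Finset.Icc 0 (fun _ => ((n / m : ℕ) : ℤ)) with hK
  have hmax := integrable_maxDual hφ hg hg0 m
  have hint : ∀ k ∈ K, Integrable (dual d μ ((m : ℤ) • k) (maxDual d μ g m)) μ :=
    fun k _ => integrable_dual hφ _ hmax
  have hle : maxDual d μ g n ≤ᵐ[μ]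
      fun s => ∑ k ∈ K, dual d μ ((m : ℤ) • k) (maxDual d μ g m) s := by
    have hcomp : ∀ᵐ s ∂μ, ∀ t u, dual d μ u (dual d μ t g) s = dual d μ (t + u) g s :=
      ae_all_iff.2 fun t => ae_all_iff.2 fun u => dual_dual hφ t u g
    filter_upwards [hcomp, dual_nonneg hφ (maxDual_nonneg hφ hg0 m)] with s hs hs'
    refine maxDual_le (Finset.sum_nonneg fun k _ => hs' _) fun t ht => ?_
    have hm0 : (0 : ℤ) < m := by exact_mod_cast hm
    have hr : (fun i => t i % m) ∈ Set.Icc (0 : Fin d → ℤ) (fun _ => (m : ℤ) - 1) :=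
      ⟨fun i => Int.emod_nonneg _ hm0.ne', fun i => Int.le_sub_one_of_lt (Int.emod_lt_of_pos _ hm0)⟩
    have hk : (fun i => t i / m) ∈ K := by
      refine Finset.mem_Icc.2 ⟨fun i => Int.ediv_nonneg (ht.1 i) hm0.le, fun i => ?_⟩
      have hti : t i ≤ n := by
        have := ht.2 i
        simp only at this
        omega
      simpa using Int.ediv_le_ediv hm0 hti
    have hsplit : t = (fun i => t i % m) + (m : ℤ) • (fun i => t i / m) := by
      ext i
      simp [Int.emod_add_mul_ediv]
    calc dual d μ t g s
        = dual d μ ((m : ℤ) • fun i => t i / m) (dual d μ (fun i => t i % m) g) s := by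
          rw [hs, ← hsplit]
      _ ≤ dual d μ ((m : ℤ) • fun i => t i / m) (maxDual d μ g m) s :=
          dual_mono (fun x => dual_le_maxDual g m hr x) _ s
      _ ≤ _ := Finset.single_le_sum
          (f := fun k => dual d μ ((m : ℤ) • k) (maxDual d μ g m) s) (fun k _ => hs' _) hk
  refine (integral_mono_ae (integrable_maxDual hφ hg hg0 n) (integrable_finsetSum K hint) hle).trans
    (le_of_eq ?_)
  rw [integral_finsetSum K hint]
  simp_rw [integral_dual hφ]
  rw [Finset.sum_const, nsmul_eq_mul, hK, Pi.card_Icc]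
  congr 1
  simp
  norm_cast

theorem tendsto_avgMax [SigmaFinite μ] (hφ : IsNonsingular d μ) {g : S → ℝ}
    (hg : Integrable g μ) (hg0 : 0 ≤ᵐ[μ] g) :
    ∃ a : ℝ, Tendsto (avgMax d μ g) atTop (𝓝 a) :=
  ⟨_, tendsto_div_pow_sInf d (fun n => ∫ s, maxDual d μ g n s ∂μ)
    (fun n => integral_nonneg_of_ae (maxDual_nonneg hφ hg0 n))
    fun m n hm _ => integral_maxDual_le hφ hg hg0 m n hm⟩

/-! ### Wandering sets and positivity of the limit -/

theorem IsWandering.eq_of_vadd_mem {W : Set S} (hW : IsWandering d W) {t u : Fin d → ℤ} {s : S}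
    (ht : t +ᵥ s ∈ W) (hu : u +ᵥ s ∈ W) : t = u := by
  by_contra hne
  have hdis := hW.2 (fun h : -t = -u => hne (neg_injective h))
  exact Set.disjoint_left.1 hdis ⟨t +ᵥ s, ht, neg_vadd_vadd t s⟩ ⟨u +ᵥ s, hu, neg_vadd_vadd u s⟩

/-- The functions `φ̂_t (1_W g)` have disjoint supports, so that the maximum over a cube dominates
their sum. -/
theorem setIntegral_le_avgMax [SigmaFinite μ] (hφ : IsNonsingular d μ) {g : S → ℝ}
    (hg : Integrable g μ) (hg0 : 0 ≤ᵐ[μ] g) {W : Set S} (hW : IsWandering d W) {n : ℕ}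
    (hn : 1 ≤ n) : ∫ s in W, g s ∂μ ≤ avgMax d μ g n := by
  set B : Finset (Fin d → ℤ) := Finset.Icc 0 (fun _ => (n : ℤ) - 1) with hB
  have hint : ∀ t ∈ B, Integrable (dual d μ t (W.indicator g)) μ :=
    fun t _ => integrable_dual hφ t (hg.indicator hW.1)
  have hle : (fun s => ∑ t ∈ B, dual d μ t (W.indicator g) s) ≤ᵐ[μ] maxDual d μ g n := by
    filter_upwards [maxDual_nonneg hφ hg0 n] with s hs
    by_cases h : ∃ t ∈ B, t +ᵥ s ∈ W
    · obtain ⟨t, htB, ht⟩ := h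
      have hsum : ∑ u ∈ B, dual d μ u (W.indicator g) s = dual d μ t g s := by
        rw [Finset.sum_eq_single_of_mem t htB fun u _ hut => ?_]
        · simp [dual, ht]
        · have : u +ᵥ s ∉ W := fun hu => hut (hW.eq_of_vadd_mem hu ht)
          simp [dual, this]
      exact hsum.trans_le (dual_le_maxDual g n (Finset.mem_Icc.1 htB) s)
    · push Not at h
      refine le_trans (le_of_eq (Finset.sum_eq_zero fun t ht => ?_)) hs
      simp [dual, h t ht]
  have h1 := integral_mono_ae (integrable_finsetSum B hint) (integrable_maxDual hφ hg hg0 n) hle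
  rw [integral_finsetSum B hint] at h1
  simp_rw [integral_dual hφ] at h1
  rw [integral_indicator hW.1, Finset.sum_const, nsmul_eq_mul, hB, Pi.card_Icc] at h1
  have hn0 : (0 : ℝ) < (n : ℝ) ^ d := by positivity
  rw [avgMax, one_div, ← div_eq_inv_mul, le_div_iff₀ hn0, mul_comm]
  simpa using h1

theorem exists_pos_tendsto_avgMax [SigmaFinite μ] (hφ : IsNonsingular d μ) {D : Set S}
    (hD : IsDissipativePart d μ D) {g : S → ℝ} (hg : Integrable g μ) (hg0 : 0 ≤ᵐ[μ] g)
    (hpos : 0 < μ (Function.support g ∩ D)) :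
    ∃ a : ℝ, 0 < a ∧ Tendsto (avgMax d μ g) atTop (𝓝 a) := by
  obtain ⟨a, ha⟩ := tendsto_avgMax hφ hg hg0
  obtain ⟨W, hW, hDW⟩ := hD.exists_iUnion
  obtain ⟨k, hk⟩ : ∃ k, 0 < μ (Function.support g ∩ W k) := by
    by_contra! hcon
    have h0 : μ (Function.support g ∩ ⋃ k, W k) = 0 := by
      rw [Set.inter_iUnion]
      exact measure_iUnion_null fun k => nonpos_iff_eq_zero.1 (hcon k)
    rw [measure_congr ((EventuallyEq.refl _ (Function.support g)).inter hDW), h0] at hpos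
    exact hpos.false
  refine ⟨a, lt_of_lt_of_le (b := ∫ s in W k, g s ∂μ) ?_ (ge_of_tendsto ha ?_), ha⟩
  · rwa [setIntegral_pos_iff_support_of_nonneg_ae (ae_restrict_of_ae hg0) hg.integrableOn]
  · filter_upwards [eventually_ge_atTop 1] with n hn
    exact setIntegral_le_avgMax hφ hg hg0 (hW k) hn

theorem support_ae_le_compl_of_tendsto_avgMax_zero [SigmaFinite μ] (hφ : IsNonsingular d μ)
    {D : Set S} (hD : IsDissipativePart d μ D) {g : S → ℝ} (hg : Integrable g μ)
    (hg0 : 0 ≤ᵐ[μ] g) (hlim : Tendsto (avgMax d μ g) atTop (𝓝 0)) :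
    Function.support g ≤ᵐ[μ] Dᶜ := by
  have hnull : μ (Function.support g ∩ D) = 0 := by
    by_contra hne
    obtain ⟨a, ha, hlim'⟩ := exists_pos_tendsto_avgMax hφ hD hg hg0 (pos_iff_ne_zero.2 hne)
    exact ha.ne (tendsto_nhds_unique hlim hlim')
  filter_upwards [measure_eq_zero_iff_ae_notMem.1 hnull] with s hs hsg hsD
  exact hs ⟨hsg, hsD⟩

end Dual

end ZdAction

theorem corollary3p2 (d : ℕ) {S : Type*} [MeasurableSpace S] [StandardBorelSpace S]
    (μ : Measure S) [SigmaFinite μ] [AddAction (Fin d → ℤ) S]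
    (hφ : ZdAction.IsNonsingular d μ) :
    -- the maxima are integrable, so that the integrals below are the true ones
    (∀ g : S → ℝ, Integrable g μ → 0 ≤ᵐ[μ] g → ∀ n : ℕ, Integrable (ZdAction.maxDual d μ g n) μ) ∧
    -- if the support of `g` meets the dissipative part, the limit exists in `(0, ∞)`
    (∀ D : Set S, ZdAction.IsDissipativePart d μ D →
      ∀ g : S → ℝ, Integrable g μ → 0 ≤ᵐ[μ] g → 0 < μ (Function.support g ∩ D) →
        ∃ a : ℝ, 0 < a ∧ Tendsto (ZdAction.avgMax d μ g) atTop (𝓝 a)) ∧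
    -- if the limit is `0`, the support of `g` lies in the conservative part
    (∀ D : Set S, ZdAction.IsDissipativePart d μ D →
      ∀ g : S → ℝ, Integrable g μ → 0 ≤ᵐ[μ] g →
        Tendsto (ZdAction.avgMax d μ g) atTop (𝓝 0) → Function.support g ≤ᵐ[μ] Dᶜ) ∧
    -- if the limit is `0` for each member of a sequence with supports increasing to `S`,
    -- the action is conservative
    (∀ g : ℕ → S → ℝ, (∀ m, Integrable (g m) μ) → (∀ m, 0 ≤ᵐ[μ] g m) →
      (∀ m, Function.support (g m) ≤ᵐ[μ] Function.support (g (m + 1))) →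
      (⋃ m, Function.support (g m)) =ᵐ[μ] Set.univ →
      (∀ m, Tendsto (ZdAction.avgMax d μ (g m)) atTop (𝓝 0)) →
        ZdAction.IsConservative d μ) := by
  refine ⟨fun g hg hg0 n => ZdAction.integrable_maxDual hφ hg hg0 n,
    fun D hD g hg hg0 hpos => ZdAction.exists_pos_tendsto_avgMax hφ hD hg hg0 hpos,
    fun D hD g hg hg0 hlim =>
      ZdAction.support_ae_le_compl_of_tendsto_avgMax_zero hφ hD hg hg0 hlim,
    fun g hg hg0 _ hunion hlim W hW => ?_⟩
  obtain ⟨D, hD⟩ := ZdAction.exists_isDissipativePart d μ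
  have hsupp : ∀ᵐ s ∂μ, ∀ m, s ∈ Function.support (g m) → s ∈ Dᶜ := ae_all_iff.2 fun m =>
    ZdAction.support_ae_le_compl_of_tendsto_avgMax_zero hφ hD (hg m) (hg0 m) (hlim m)
  rw [measure_eq_zero_iff_ae_notMem]
  filter_upwards [hsupp, hunion.mem_iff, hD.ae_le W hW] with s hs hsU hsD hsW
  obtain ⟨m, hm⟩ := Set.mem_iUnion.1 (hsU.2 (Set.mem_univ s))
  exact hs m hm (hsD hsW)
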